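/- Let $\eta>50$ be a fixed real number and, for integers $n$ large enough that $p_n:=\frac{\eta\log n}{n-1}\le 1$, let $(G_t)_{t\in\mathbb Z}$ be a sequence of independent Erdős–Rényi random graphs $G(n,p_n)$ on the vertex set $[n]=\{1,\dots,n\}$, with joint law $\mathbf P=\mathbf P_n$. Write $\deg_t(x)$ for the degree of $x$ in $G_t$ and let $P_t$ be the transition matrix of the lazy simple random walk on $G_t$: if $\deg_t(x)\ge 1$, then $P_t(x,x)=\frac12$ and $P_t(x,y)=\frac1{2\deg_t(x)}$ for every neighbour $y$ of $x$ in $G_t$; if $\deg_t(x)=0$, then $P_t(x,x)=1$; all other entries are $0$. For $s\le t$ put $P^{s,t}=P_{s+1}P_{s+2}\cdots P_t$ (the identity matrix if $s=t$). We say that the target distribution $\pi_t$ exists if for every $y\in[n]$ the limit $\pi_t(y)=\lim_{s\to-\infty}P^{s,t}(x,y)$ exists for every $x\in[n]$ and does not depend on $x$. If the target distributions exist, the (quenched) mixing time of the sequence $(P_t)_{t\in\mathbb Z}$ is, for $\varepsilon\in(0,1)$ and $s\in\mathbb Z$, $$t_{\mathrm{mix}}(\varepsilon,s)=\inf\Big\{t\in\mathbb{Z}_{\ge0}:\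 \max_{x\in[n]}\tfrac12\sum_{y\in[n]}\big|P^{s,s+t}(x,y)-\pi_{s+t}(y)\big|\le\varepsilon\Big\},\qquad \inf\emptyset=\infty .$$ **Theorem.** There is a constant $c'=c'(\eta)>0$, depending only on $\eta$, such that for every $\varepsilon\in(0,1)$ $$\lim_{n\to\infty}\mathbf P\Big(\pi_t\text{ exists for every }t\in\mathbb Z\ \text{ and }\ t_{\mathrm{mix}}(\varepsilon,0)\le c'\big[\log n+\log(\varepsilon^{-1})\big]\Big)=1 .$$ -/

import Mathlib

open Filter Topology MeasureTheory
open scoped ENNReal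

noncomputable section

namespace DynamicER

/-- The transition matrix of the lazy simple random walk on `G`: the walk at `x` stays put with
probability `1/2` and otherwise moves to a uniformly chosen neighbour; it never leaves an isolated
vertex. -/
def lazyWalk {n : ℕ} (G : SimpleGraph (Fin n)) : Matrix (Fin n) (Fin n) ℝ :=
  open Classical in
  fun x y =>
    if x = y then (if G.degree x = 0 then 1 else 1 / 2)
    else if G.Adj x y then 1 / (2 * (G.degree x : ℝ))
    else 0

/-- `stepProd P s k` is the product `P_{s+1} P_{s+2} ⋯ P_{s+k}` (the identity for `k = 0`). -/
def stepProd {n : ℕ} (P : ℤ → Matrix (Fin n) (Fin n) ℝ) (s : ℤ) : ℕ → Matrix (Fin n) (Fin n) ℝ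
  | 0 => 1
  | k + 1 => stepProd P s k * P (s + k + 1)

/-- `P^{s,t} = P_{s+1} ⋯ P_t` for `s ≤ t` (used only for `s ≤ t`). -/
def transition {n : ℕ} (P : ℤ → Matrix (Fin n) (Fin n) ℝ) (s t : ℤ) : Matrix (Fin n) (Fin n) ℝ :=
  stepProd P s (t - s).toNat

/-- `π` is the target distribution at time `t`: for every starting state `x`, the rows
`P^{s,t}(x, ·)` converge to `π` as `s → -∞`. -/
def IsTarget {n : ℕ} (P : ℤ → Matrix (Fin n) (Fin n) ℝ) (t : ℤ) (π : Fin n → ℝ) : Prop :=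
  ∀ x y, Tendsto (fun s : ℤ => transition P s t x y) atBot (𝓝 (π y))

/-- The target distribution `π_t` exists. -/
def TargetExists {n : ℕ} (P : ℤ → Matrix (Fin n) (Fin n) ℝ) (t : ℤ) : Prop :=
  ∃ π : Fin n → ℝ, IsTarget P t π

/-- The target distribution `π_t` (meaningful when `TargetExists P t`; it is then the unique `π`
with `IsTarget P t π`, provided `n ≥ 1`). -/
def target {n : ℕ} (P : ℤ → Matrix (Fin n) (Fin n) ℝ) (t : ℤ) : Fin n → ℝ :=
  Classical.epsilon (IsTarget P t)

/-- Total variation distance on a finite set. -/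
def tvDist {n : ℕ} (μ ν : Fin n → ℝ) : ℝ := (1 / 2) * ∑ x, |μ x - ν x|

/-- `d(s,t) = sup_x ‖P^{s,t}(x, ·) - π_t‖_TV`. -/
def mixDist {n : ℕ} (P : ℤ → Matrix (Fin n) (Fin n) ℝ) (s t : ℤ) : ℝ :=
  ⨆ x : Fin n, tvDist (fun y => transition P s t x y) (target P t)

/-- `t_mix^P(ε, s) = inf {t ≥ 0 : d(s, s+t) ≤ ε}`, equal to `⊤` if there is no such `t`. -/
def mixingTime {n : ℕ} (P : ℤ → Matrix (Fin n) (Fin n) ℝ) (ε : ℝ) (s : ℤ) : ℕ∞ :=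
  ⨅ t ∈ {t : ℕ | mixDist P s (s + t) ≤ ε}, (t : ℕ∞)

/-- The edge probability `p = η log n / (n - 1)`. It is truncated to `[0,1]`, which changes it only
for finitely many `n`. -/
def edgeProb (η : ℝ) (n : ℕ) : unitInterval :=
  Set.projIcc (0 : ℝ) 1 zero_le_one (η * Real.log n / ((n : ℝ) - 1))

/-- The law of a sequence `(G_t)_{t ∈ ℤ}` of independent Erdős–Rényi graphs `G(n, p)`. -/
def dynamicER (n : ℕ) (p : unitInterval) : Measure (ℤ → SimpleGraph (Fin n)) :=
  Measure.infinitePi (fun _ : ℤ => SimpleGraph.binomialRandom (Fin n) p)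

end DynamicER

end

/-!
The proof is an `ℓ²` argument, averaged over the randomness of the graphs, which needs no spectral
estimate for a typical `G(n, p)`.

Let `P` be the lazy walk on one random graph. The law of the graph is invariant under relabelling
the vertices, so `E[P Pᵀ]` has a constant diagonal entry `α` and a constant off-diagonal entry
`β ≥ 0` (`exists_integral_rowCorr_eq`). For a random vector `w` with zero sum that is independent of
`P`, this gives `E‖w P‖² = (α - β) E‖w‖² ≤ α E‖w‖²`. A row of `P` has squared norm at most `1 / 2`
unless its vertex is isolated (`lazyWalk_sum_sq_le`), and isolation has probability at most `1 / 2`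
(`one_sub_edgeProb_pow_le`), whence `α ≤ 3 / 4`.

The graphs at different times are independent, so the step can be iterated
(`integral_sum_sq_vecMul_stepProd_le`); applied to differences of unit vectors it shows that the sum
`rowGap` of all squared distances between two rows of `P^{s,s+k}` has mean at most
`2 n² (3 / 4) ^ k` (`integral_rowGap_stepProd_le`).

Two deterministic facts finish the argument. If the rows of `P^{t-k,t}` merge as `k → ∞`, then the
target distribution at time `t` exists (`targetExists_of_tendsto_rowGap`); summability of the means
makes this happen almost surely. And since `π_{s+k}` is a limit of convex combinations of the rows
of `P^{s,s+k}`, the distance to it is bounded by `rowGap` (`mixDist_le`). Markov's inequality at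
`k = ⌊24 (log n + log ε⁻¹)⌋`, where `(3 / 4) ^ k` is of order `(ε / n) ^ 6`, bounds the mixing time
outside an event of probability at most `3 / n²`.
-/

/-! ### Exchangeability and isolated vertices of binomial random graphs -/

namespace SimpleGraph

open ProbabilityTheory unitInterval

instance instMeasurableSingletonClass {V : Type*} [Countable V] :
    MeasurableSingletonClass (SimpleGraph V) where
  measurableSet_singleton G := by
    have h : ({G} : Set (SimpleGraph V)) = Adj ⁻¹' {G.Adj} := by
      ext H
      simp [adj_inj]
    rw [h]
    exact measurable_adj (measurableSet_singleton _)

lemma binomialRandom_singleton_simpleGraph {V : Type*} [Finite V] (p : I) (τ : V ≃ V)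
    (G : SimpleGraph V) :
    binomialRandom V p {τ.simpleGraph G} = binomialRandom V p {G} := by
  have h : (τ.simpleGraph G).edgeSet.ncard = G.edgeSet.ncard :=
    Nat.card_congr (Iso.comap τ.symm G).mapEdgeSet
  rw [binomialRandom_singleton, binomialRandom_singleton, h]

/-- The law of a binomial random graph is invariant under relabelling of the vertices. -/
lemma integral_binomialRandom_simpleGraph {V : Type*} [Finite V] (p : I) (τ : V ≃ V)
    (f : SimpleGraph V → ℝ) :
    ∫ G, f (τ.simpleGraph G) ∂binomialRandom V p = ∫ G, f G ∂binomialRandom V p := by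
  classical
  have := Fintype.ofFinite V
  have := Fintype.ofFinite (SimpleGraph V)
  rw [integral_fintype .of_finite, integral_fintype .of_finite,
    ← Equiv.sum_comp τ.simpleGraph fun G ↦ (binomialRandom V p).real {G} • f G]
  simp only [measureReal_def, binomialRandom_singleton_simpleGraph]

/-- An isolated vertex `x` misses the `|V| - 1` edges `s(x, y)` with `y ≠ x`, each of which is
absent independently with probability `1 - p`. -/
lemma binomialRandom_isolated_le {V : Type*} [Fintype V] (p : I) (x : V) :
    (binomialRandom V p).real {G | ∀ y, ¬ G.Adj x y} ≤ (1 - (p : ℝ)) ^ (Fintype.card V - 1) := by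
  classical
  set E : Finset (Sym2 V) := (Finset.univ.erase x).image fun y ↦ s(x, y) with hE
  have hsub : edgeSet '' {G : SimpleGraph V | ∀ y, ¬ G.Adj x y} ⊆
      {S : Set (Sym2 V) | ∀ e ∈ E, e ∉ S} := by
    rintro _ ⟨G, hG, rfl⟩ e he
    obtain ⟨y, -, rfl⟩ := Finset.mem_image.1 he
    exact hG y
  have hcard : E.card = Fintype.card V - 1 := by
    rw [hE, Finset.card_image_of_injective _ (fun a b h ↦ Sym2.congr_right.1 h),
      Finset.card_erase_of_mem (Finset.mem_univ _), Finset.card_univ]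
  have hval : setBernoulli (Sym2.diagSet : Set (Sym2 V))ᶜ p {S | ∀ e ∈ E, e ∉ S} =
      toNNReal (σ p) ^ (Fintype.card V - 1) := by
    have hset : (fun q : Sym2 V → Prop ↦ {i | q i}) ⁻¹' {S | ∀ e ∈ E, e ∉ S} =
        Set.pi (E : Set (Sym2 V)) fun _ ↦ {False} := by
      ext q
      simp [Set.mem_pi]
    rw [setBernoulli_apply', hset, Measure.infinitePi_pi _ (fun _ _ ↦ .singleton _), ← hcard,
      ← Finset.prod_const]
    refine Finset.prod_congr rfl fun e he ↦ ?_
    obtain ⟨y, hy, rfl⟩ := Finset.mem_image.1 he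
    have hxy : x ≠ y := (Finset.ne_of_mem_erase hy).symm
    simp [hxy]
  rw [measureReal_def, binomialRandom_apply']
  refine (ENNReal.toReal_mono (measure_ne_top _ _) (measure_mono hsub)).trans ?_
  rw [hval]
  simp

end SimpleGraph

/-! ### The lazy walk on a graph -/

namespace DynamicER

variable {n : ℕ}

lemma lazyWalk_nonneg (G : SimpleGraph (Fin n)) (x y : Fin n) : 0 ≤ lazyWalk G x y := by
  classical
  unfold lazyWalk
  split_ifs <;> positivity

lemma lazyWalk_of_isolated {G : SimpleGraph (Fin n)} {x : Fin n} (h : ∀ y, ¬ G.Adj x y) :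
    lazyWalk G x = (1 : Matrix (Fin n) (Fin n) ℝ) x := by
  classical
  ext y
  have : G.degree x = 0 := by
    rw [SimpleGraph.degree_eq_zero_iff_notMem_support, SimpleGraph.mem_support]
    exact fun ⟨y, hy⟩ ↦ h y hy
  simp only [lazyWalk, h, Matrix.one_apply]
  split_ifs with h1 h2
  · rfl
  · contradiction
  · rfl

lemma lazyWalk_sum (G : SimpleGraph (Fin n)) (x : Fin n) : ∑ y, lazyWalk G x y = 1 := by
  classical
  by_cases h : ∀ y, ¬ G.Adj x y
  · simp [lazyWalk_of_isolated h, Matrix.one_apply]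
  push Not at h
  have hd : 0 < G.degree x := (G.degree_pos_iff_exists_adj x).2 h
  have hd' : (0 : ℝ) < G.degree x := by exact_mod_cast hd
  have hrow : ∀ y, lazyWalk G x y = (if x = y then 1 / 2 else 0) +
      if G.Adj x y then 1 / (2 * (G.degree x : ℝ)) else 0 := by
    intro y
    unfold lazyWalk
    by_cases hxy : x = y
    · subst hxy
      have h0 : ∀ i, @SimpleGraph.degree _ G x i ≠ 0 := fun i ↦ by convert hd.ne'
      simp [h0]
    · simp only [hxy, ↓reduceIte, zero_add]
  simp only [hrow, Finset.sum_add_distrib, Finset.sum_ite_eq, Finset.mem_univ, ↓reduceIte]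
  rw [← Finset.sum_filter, ← SimpleGraph.neighborFinset_eq_filter, Finset.sum_const,
    SimpleGraph.card_neighborFinset_eq_degree, nsmul_eq_mul]
  field_simp
  norm_num

lemma lazyWalk_mem_rowStochastic (G : SimpleGraph (Fin n)) :
    lazyWalk G ∈ Matrix.rowStochastic ℝ (Fin n) :=
  Matrix.mem_rowStochastic_iff_sum.2 ⟨lazyWalk_nonneg G, lazyWalk_sum G⟩

lemma lazyWalk_le_half {G : SimpleGraph (Fin n)} {x : Fin n} (h : ∃ y, G.Adj x y) (y : Fin n) :
    lazyWalk G x y ≤ 1 / 2 := by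
  classical
  have hd : 0 < G.degree x := (G.degree_pos_iff_exists_adj x).2 h
  have hd' : (1 : ℝ) ≤ G.degree x := by exact_mod_cast hd
  unfold lazyWalk
  split_ifs with h1 h2 h3
  · exact absurd (by convert h2) hd.ne'
  · rfl
  · have h2 : (1 : ℝ) / (2 * (G.degree x : ℝ)) ≤ 1 / 2 :=
      one_div_le_one_div_of_le (by norm_num) (by linarith)
    convert h2
  · norm_num

/-- The squared `ℓ²` norm of a row of the lazy walk is at most `1 / 2`, except at an isolated
vertex, where it is `1`. -/
lemma lazyWalk_sum_sq_le (G : SimpleGraph (Fin n)) (x : Fin n) :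
    ∑ y, lazyWalk G x y ^ 2 ≤
      1 / 2 + 1 / 2 * Set.indicator {G : SimpleGraph (Fin n) | ∀ y, ¬ G.Adj x y} 1 G := by
  by_cases h : ∀ y, ¬ G.Adj x y
  · rw [Set.indicator_of_mem (by exact h)]
    norm_num [lazyWalk_of_isolated h, Matrix.one_apply]
  · rw [Set.indicator_of_notMem (by exact h)]
    push Not at h
    calc ∑ y, lazyWalk G x y ^ 2 ≤ ∑ y, 1 / 2 * lazyWalk G x y := by
          refine Finset.sum_le_sum fun y _ ↦ ?_
          nlinarith [lazyWalk_nonneg G x y, lazyWalk_le_half h y]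
      _ = 1 / 2 + 1 / 2 * 0 := by rw [← Finset.mul_sum, lazyWalk_sum]; norm_num

lemma lazyWalk_simpleGraph (τ : Equiv.Perm (Fin n)) (G : SimpleGraph (Fin n)) (x y : Fin n) :
    lazyWalk (Equiv.simpleGraph τ G) (τ x) (τ y) = lazyWalk G x y := by
  classical
  have hadj : ∀ a b, (Equiv.simpleGraph τ G).Adj (τ a) (τ b) ↔ G.Adj a b := by
    intro a b
    simp [Equiv.simpleGraph]
  have hdeg : (Equiv.simpleGraph τ G).degree (τ x) = G.degree x := by
    have h := (SimpleGraph.Iso.comap τ.symm G).symm.degree_eq x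
    convert h <;> rfl
  unfold lazyWalk
  simp only [τ.injective.eq_iff, hadj]
  congr! 5

end DynamicER

/-! ### Merging of rows and the target distribution -/

namespace DynamicER

variable {n : ℕ}

/-- The sum over all pairs of rows of a matrix of the squared `ℓ²` distance between the rows. -/
def rowGap (A : Matrix (Fin n) (Fin n) ℝ) : ℝ := ∑ x, ∑ x', ∑ y, (A x y - A x' y) ^ 2

lemma rowGap_nonneg (A : Matrix (Fin n) (Fin n) ℝ) : 0 ≤ rowGap A := by
  unfold rowGap
  positivity

lemma abs_sub_le_sqrt_rowGap (A : Matrix (Fin n) (Fin n) ℝ) (x x' y : Fin n) :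
    |A x y - A x' y| ≤ √(rowGap A) := by
  refine Real.abs_le_sqrt ?_
  calc (A x y - A x' y) ^ 2 ≤ ∑ y, (A x y - A x' y) ^ 2 :=
        Finset.single_le_sum (f := fun y ↦ (A x y - A x' y) ^ 2) (fun _ _ ↦ sq_nonneg _)
          (Finset.mem_univ y)
    _ ≤ ∑ x', ∑ y, (A x y - A x' y) ^ 2 :=
        Finset.single_le_sum (f := fun x' ↦ ∑ y, (A x y - A x' y) ^ 2)
          (fun _ _ ↦ by positivity) (Finset.mem_univ x')
    _ ≤ rowGap A :=
        Finset.single_le_sum (f := fun x ↦ ∑ x', ∑ y, (A x y - A x' y) ^ 2)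
          (fun _ _ ↦ by positivity) (Finset.mem_univ x)

/-- The rows of `Q * A` are convex combinations of the rows of `A`, so they are as close to the
rows of `A` as these are to each other. -/
lemma abs_mul_sub_le_sqrt_rowGap {Q : Matrix (Fin n) (Fin n) ℝ}
    (hQ : Q ∈ Matrix.rowStochastic ℝ (Fin n)) (A : Matrix (Fin n) (Fin n) ℝ) (x x' y : Fin n) :
    |(Q * A) x y - A x' y| ≤ √(rowGap A) := by
  have hsum := Matrix.sum_row_of_mem_rowStochastic hQ x
  have h : (Q * A) x y - A x' y = ∑ z, Q x z * (A z y - A x' y) := by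
    simp only [mul_sub, Finset.sum_sub_distrib, ← Finset.sum_mul, hsum, one_mul, Matrix.mul_apply]
  rw [h]
  calc |∑ z, Q x z * (A z y - A x' y)| ≤ ∑ z, |Q x z * (A z y - A x' y)| :=
        Finset.abs_sum_le_sum_abs _ _
    _ ≤ ∑ z, Q x z * √(rowGap A) := by
        refine Finset.sum_le_sum fun z _ ↦ ?_
        have hz : 0 ≤ Q x z := Matrix.nonneg_of_mem_rowStochastic hQ
        rw [abs_mul, abs_of_nonneg hz]
        exact mul_le_mul_of_nonneg_left (abs_sub_le_sqrt_rowGap A z x' y) hz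
    _ = √(rowGap A) := by rw [← Finset.sum_mul, hsum, one_mul]

lemma stepProd_mem_rowStochastic {P : ℤ → Matrix (Fin n) (Fin n) ℝ}
    (hP : ∀ t, P t ∈ Matrix.rowStochastic ℝ (Fin n)) (s : ℤ) (k : ℕ) :
    stepProd P s k ∈ Matrix.rowStochastic ℝ (Fin n) := by
  induction k with
  | zero => exact one_mem _
  | succ k ih => exact mul_mem ih (hP _)

lemma stepProd_add (P : ℤ → Matrix (Fin n) (Fin n) ℝ) (s : ℤ) (j k : ℕ) :
    stepProd P s (j + k) = stepProd P s j * stepProd P (s + j) k := by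
  induction k with
  | zero => simp [stepProd]
  | succ k ih =>
    rw [← add_assoc, stepProd, stepProd, ih, Matrix.mul_assoc]
    push_cast
    simp only [add_assoc]

/-- The target distribution at time `t` exists once the rows of `P^{t-k,t}` merge as `k → ∞`:
by `abs_mul_sub_le_sqrt_rowGap` they then form Cauchy sequences with a common limit. -/
lemma targetExists_of_tendsto_rowGap {P : ℤ → Matrix (Fin n) (Fin n) ℝ}
    (hP : ∀ t, P t ∈ Matrix.rowStochastic ℝ (Fin n)) (t : ℤ)
    (h : Tendsto (fun k : ℕ ↦ rowGap (stepProd P (t - k) k)) atTop (𝓝 0)) :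
    TargetExists P t := by
  set a : ℕ → Matrix (Fin n) (Fin n) ℝ := fun k ↦ stepProd P (t - k) k with ha
  have hsqrt : Tendsto (fun k ↦ √(rowGap (a k))) atTop (𝓝 0) := by
    simpa only [Real.sqrt_zero] using h.sqrt
  have hstep : ∀ {N m : ℕ}, N ≤ m → ∀ x x' y, |a m x y - a N x' y| ≤ √(rowGap (a N)) := by
    intro N m hNm x x' y
    have hm : a m = stepProd P (t - m) (m - N) * a N := by
      have h1 := stepProd_add P (t - m) (m - N) N
      have h2 : t - m + ((m - N : ℕ) : ℤ) = t - N := by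
        push_cast [hNm]
        ring
      rwa [Nat.sub_add_cancel hNm, h2] at h1
    rw [hm]
    exact abs_mul_sub_le_sqrt_rowGap (stepProd_mem_rowStochastic hP _ _) _ x x' y
  have hlim : ∀ y, ∃ l, ∀ x, Tendsto (fun k ↦ a k x y) atTop (𝓝 l) := by
    intro y
    rcases isEmpty_or_nonempty (Fin n) with hn | ⟨⟨x₀⟩⟩
    · exact ⟨0, fun x ↦ isEmptyElim x⟩
    have hc : CauchySeq fun k ↦ a k x₀ y := by
      refine cauchySeq_of_le_tendsto_0 (fun k ↦ √(rowGap (a k)) + √(rowGap (a k)))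
        (fun k m N hk hm ↦ ?_) (by simpa using hsqrt.add hsqrt)
      refine (dist_triangle_right _ _ (a N x₀ y)).trans ?_
      rw [Real.dist_eq, Real.dist_eq]
      exact add_le_add (hstep hk x₀ x₀ y) (hstep hm x₀ x₀ y)
    obtain ⟨l, hl⟩ := cauchySeq_tendsto_of_complete hc
    refine ⟨l, fun x ↦ ?_⟩
    have hd : Tendsto (fun k ↦ a k x y - a k x₀ y) atTop (𝓝 0) :=
      squeeze_zero_norm (fun k ↦ abs_sub_le_sqrt_rowGap (a k) x x₀ y) hsqrt
    simpa using hd.add hl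
  choose π hπ using hlim
  refine ⟨π, fun x y ↦ ?_⟩
  have hs : Tendsto (fun s : ℤ ↦ (t - s).toNat) atBot atTop := by
    refine tendsto_atTop.2 fun b ↦ ?_
    filter_upwards [eventually_le_atBot (t - b)] with s hs
    omega
  refine ((hπ y x).comp hs).congr' ?_
  filter_upwards [eventually_le_atBot t] with s hs
  have h1 : t - ((t - s).toNat : ℤ) = s := by omega
  simp only [Function.comp_apply, ha, transition, h1]

lemma isTarget_target {P : ℤ → Matrix (Fin n) (Fin n) ℝ} {t : ℤ} (h : TargetExists P t) :
    IsTarget P t (target P t) :=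
  Classical.epsilon_spec h

lemma mixDist_le {P : ℤ → Matrix (Fin n) (Fin n) ℝ}
    (hP : ∀ t, P t ∈ Matrix.rowStochastic ℝ (Fin n)) (s : ℤ) (k : ℕ)
    (h : TargetExists P (s + k)) :
    mixDist P s (s + k) ≤ n * √(rowGap (stepProd P s k)) := by
  set A := stepProd P s k with hA
  have htr : transition P s (s + k) = A := by simp [transition, hA]
  refine Real.iSup_le (fun x ↦ ?_) (by positivity)
  have hentry : ∀ y, |A x y - target P (s + k) y| ≤ √(rowGap A) := by
    intro y
    have hl := ((isTarget_target h x y).sub_const (A x y)).abs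
    rw [abs_sub_comm]
    refine le_of_tendsto hl ?_
    filter_upwards [eventually_le_atBot s] with r hr
    have h1 : transition P r (s + k) = stepProd P r (s - r).toNat * A := by
      have h2 := stepProd_add P r (s - r).toNat k
      have h3 : r + ((s - r).toNat : ℤ) = s := by omega
      have h4 : (s + k - r).toNat = (s - r).toNat + k := by omega
      rw [transition, h4, h2, h3]
    rw [h1]
    exact abs_mul_sub_le_sqrt_rowGap (stepProd_mem_rowStochastic hP _ _) _ x x y
  rw [htr]
  calc tvDist (fun y ↦ A x y) (target P (s + k)) ≤ 1 / 2 * ∑ _y : Fin n, √(rowGap A) := by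
        unfold tvDist
        gcongr with y
        exact hentry y
    _ ≤ n * √(rowGap A) := by
        have : 0 ≤ (n : ℝ) * √(rowGap A) := by positivity
        simp only [Finset.sum_const, Finset.card_univ, Fintype.card_fin, nsmul_eq_mul]
        linarith

end DynamicER

/-! ### Contraction of the mean squared norm -/

namespace DynamicER

open ProbabilityTheory unitInterval

variable {n : ℕ}

/-- The correlation `(P Pᵀ)(x, x')` of two rows of the lazy walk `P` on `G`. -/
noncomputable def rowCorr (G : SimpleGraph (Fin n)) (x x' : Fin n) : ℝ :=
  ∑ y, lazyWalk G x y * lazyWalk G x' y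

lemma integral_rowCorr_perm (p : I) (τ : Equiv.Perm (Fin n)) (x x' : Fin n) :
    ∫ G, rowCorr G (τ x) (τ x') ∂SimpleGraph.binomialRandom (Fin n) p =
      ∫ G, rowCorr G x x' ∂SimpleGraph.binomialRandom (Fin n) p := by
  rw [← SimpleGraph.integral_binomialRandom_simpleGraph p τ]
  congr 1 with G
  unfold rowCorr
  rw [← Equiv.sum_comp τ]
  simp only [lazyWalk_simpleGraph]

lemma integral_rowCorr_self_le {p : I} (hp : (1 - (p : ℝ)) ^ (n - 1) ≤ 1 / 2) (x : Fin n) :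
    ∫ G, rowCorr G x x ∂SimpleGraph.binomialRandom (Fin n) p ≤ 3 / 4 := by
  set μ := SimpleGraph.binomialRandom (Fin n) p
  set S : Set (SimpleGraph (Fin n)) := {G | ∀ y, ¬ G.Adj x y}
  have hS : μ.real S ≤ 1 / 2 := by
    refine (SimpleGraph.binomialRandom_isolated_le p x).trans ?_
    simpa using hp
  have hle : ∀ G, rowCorr G x x ≤ 1 / 2 + 1 / 2 * S.indicator 1 G := by
    intro G
    simpa only [rowCorr, ← sq] using lazyWalk_sum_sq_le G x
  calc ∫ G, rowCorr G x x ∂μ ≤ ∫ G, (1 / 2 + 1 / 2 * S.indicator 1 G : ℝ) ∂μ :=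
        integral_mono .of_finite .of_finite hle
    _ = 1 / 2 + 1 / 2 * μ.real S := by
        rw [integral_add .of_finite .of_finite, integral_const_mul,
          integral_indicator_one (Set.toFinite S).measurableSet]
        simp
    _ ≤ 3 / 4 := by linarith

/-- By exchangeability, the mean of `P Pᵀ` has a constant diagonal `α` and a constant
off-diagonal entry `β`. -/
lemma exists_integral_rowCorr_eq (hn : 2 ≤ n) {p : I} (hp : (1 - (p : ℝ)) ^ (n - 1) ≤ 1 / 2) :
    ∃ α β : ℝ, α ≤ 3 / 4 ∧ 0 ≤ β ∧ ∀ x x' : Fin n,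
      ∫ G, rowCorr G x x' ∂SimpleGraph.binomialRandom (Fin n) p = if x = x' then α else β := by
  set κ : Fin n → Fin n → ℝ := fun x x' ↦
    ∫ G, rowCorr G x x' ∂SimpleGraph.binomialRandom (Fin n) p with hκ
  let a : Fin n := ⟨0, by omega⟩
  let b : Fin n := ⟨1, by omega⟩
  have hab : a ≠ b := by simp [a, b]
  refine ⟨κ a a, κ a b, integral_rowCorr_self_le hp a, ?_, fun x x' ↦ ?_⟩
  · refine integral_nonneg fun G ↦ Finset.sum_nonneg fun y _ ↦ ?_
    exact mul_nonneg (lazyWalk_nonneg _ _ _) (lazyWalk_nonneg _ _ _)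
  · split_ifs with h
    · subst h
      have := integral_rowCorr_perm p (Equiv.swap a x) a a
      rwa [Equiv.swap_apply_left] at this
    · obtain ⟨τ, h1, h2⟩ := MulAction.is_two_pretransitive_iff.1
        (Equiv.Perm.isMultiplyPretransitive (Fin n) 2) hab h
      have := integral_rowCorr_perm p τ a b
      rw [Equiv.Perm.smul_def] at h1 h2
      rwa [h1, h2] at this

instance (n : ℕ) (p : I) : IsProbabilityMeasure (dynamicER n p) := by
  unfold dynamicER
  infer_instance

/-- A function `F` of the sequence of graphs that only depends on the graphs at times in `S`
factors through the restriction to `S`. -/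
lemma exists_eq_comp_restrict {F : (ℤ → SimpleGraph (Fin n)) → ℝ} {S : Finset ℤ}
    (hF : ∀ G G', (∀ i ∈ S, G i = G' i) → F G = F G') :
    ∃ φ : (S → SimpleGraph (Fin n)) → ℝ, ∀ G, F G = φ (fun i ↦ G i) := by
  refine ⟨fun g ↦ F fun i ↦ if h : i ∈ S then g ⟨i, h⟩ else ⊥, fun G ↦ hF _ _ fun i hi ↦ ?_⟩
  simp [hi]

lemma measurable_of_dependsOn {F : (ℤ → SimpleGraph (Fin n)) → ℝ} {S : Finset ℤ}
    (hF : ∀ G G', (∀ i ∈ S, G i = G' i) → F G = F G') : Measurable F := by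
  obtain ⟨φ, hφ⟩ := exists_eq_comp_restrict hF
  rw [funext hφ]
  exact (Measurable.of_discrete (f := φ)).comp (by fun_prop)

lemma integrable_of_dependsOn (p : I) {F : (ℤ → SimpleGraph (Fin n)) → ℝ} {S : Finset ℤ}
    (hF : ∀ G G', (∀ i ∈ S, G i = G' i) → F G = F G') : Integrable F (dynamicER n p) := by
  obtain ⟨φ, hφ⟩ := exists_eq_comp_restrict hF
  obtain ⟨C, hC⟩ := (Set.finite_range fun g ↦ ‖φ g‖).bddAbove
  refine .of_bound (measurable_of_dependsOn hF).aestronglyMeasurable C (.of_forall fun G ↦ ?_)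
  rw [hφ]
  exact hC ⟨_, rfl⟩

/-- The graph at time `t` is independent of the graphs at times in `S` if `t ∉ S`. -/
lemma integral_mul_eval (p : I) {F : (ℤ → SimpleGraph (Fin n)) → ℝ} {S : Finset ℤ}
    (hF : ∀ G G', (∀ i ∈ S, G i = G' i) → F G = F G') {t : ℤ} (ht : t ∉ S)
    (f : SimpleGraph (Fin n) → ℝ) :
    ∫ G, F G * f (G t) ∂dynamicER n p =
      (∫ G, F G ∂dynamicER n p) * ∫ g, f g ∂SimpleGraph.binomialRandom (Fin n) p := by
  obtain ⟨φ, hφ⟩ := exists_eq_comp_restrict hF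
  have hind : iIndepFun (fun (i : ℤ) (G : ℤ → SimpleGraph (Fin n)) ↦ G i) (dynamicER n p) :=
    iIndepFun_infinitePi (X := fun _ g ↦ g) fun _ ↦ measurable_id
  have h1 := hind.indepFun_finset S {t} (Finset.disjoint_singleton_right.2 ht)
    fun i ↦ measurable_pi_apply i
  have h2 := h1.comp (Measurable.of_discrete (f := φ))
    (Measurable.of_discrete (f := fun g : ({t} : Finset ℤ) → SimpleGraph (Fin n) ↦
      f (g ⟨t, Finset.mem_singleton_self t⟩)))
  have hft : Measurable fun G : ℤ → SimpleGraph (Fin n) ↦ f (G t) :=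
    (Measurable.of_discrete (f := f)).comp (measurable_pi_apply t)
  have h3 := h2.integral_fun_mul_eq_mul_integral
    ((Measurable.of_discrete (f := φ)).comp (by fun_prop)).aestronglyMeasurable
    hft.aestronglyMeasurable
  have h4 : ∫ G, f (G t) ∂dynamicER n p = ∫ g, f g ∂SimpleGraph.binomialRandom (Fin n) p := by
    have hmap := Measure.infinitePi_map_eval
      (fun _ : ℤ ↦ SimpleGraph.binomialRandom (Fin n) p) t
    rw [← hmap, integral_map (measurable_pi_apply t).aemeasurable
      (Measurable.of_discrete (f := f)).aestronglyMeasurable]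
    rfl
  simp only [hφ]
  rw [← h4]
  exact h3

/-- The matrix `P^{s,s+k}` only depends on the graphs at the times `s + 1, …, s + k`. -/
lemma stepProd_congr {P P' : ℤ → Matrix (Fin n) (Fin n) ℝ} {s : ℤ} {k : ℕ}
    (h : ∀ i ∈ Finset.Ioc s (s + k), P i = P' i) : stepProd P s k = stepProd P' s k := by
  induction k with
  | zero => rfl
  | succ k ih =>
    rw [stepProd, stepProd, ih fun i hi ↦ h i ?_, h _ ?_]
    all_goals
      simp only [Finset.mem_Ioc] at *
      push_cast at *
      omega

open scoped Matrix in
/-- Each step of the walk contracts the mean squared `ℓ²` norm of a vector `v` with zero sum by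
the factor `3 / 4`. -/
lemma integral_sum_sq_vecMul_stepProd_le (hn : 2 ≤ n) {p : I}
    (hp : (1 - (p : ℝ)) ^ (n - 1) ≤ 1 / 2) (s : ℤ) {v : Fin n → ℝ} (hv : ∑ x, v x = 0) (k : ℕ) :
    ∫ G, ∑ y, (v ᵥ* stepProd (fun t ↦ lazyWalk (G t)) s k) y ^ 2 ∂dynamicER n p ≤
      (3 / 4) ^ k * ∑ x, v x ^ 2 := by
  obtain ⟨α, β, hα, hβ, hκ⟩ := exists_integral_rowCorr_eq hn hp
  induction k with
  | zero => simp [stepProd]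
  | succ k ih =>
    set w : (ℤ → SimpleGraph (Fin n)) → Fin n → ℝ := fun G ↦
      v ᵥ* stepProd (fun t ↦ lazyWalk (G t)) s k with hw
    have hwdep : ∀ G G', (∀ i ∈ Finset.Ioc s (s + k), G i = G' i) → w G = w G' := by
      intro G G' h
      simp only [hw]
      rw [stepProd_congr fun i hi ↦ by rw [h i hi]]
    have hwsum : ∀ G, ∑ x, w G x = 0 := by
      intro G
      have h1 := stepProd_mem_rowStochastic (fun t ↦ lazyWalk_mem_rowStochastic (G t)) s k
      simp only [hw, Matrix.vecMul, dotProduct]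
      rw [Finset.sum_comm]
      simp only [← Finset.mul_sum, Matrix.sum_row_of_mem_rowStochastic h1, mul_one, hv]
    have hexp : ∀ G : ℤ → SimpleGraph (Fin n),
        ∑ y, (v ᵥ* stepProd (fun t ↦ lazyWalk (G t)) s (k + 1)) y ^ 2 =
          ∑ x, ∑ x', w G x * w G x' * rowCorr (G (s + k + 1)) x x' := by
      intro G
      rw [stepProd, ← Matrix.vecMul_vecMul]
      change ∑ y, (w G ᵥ* lazyWalk (G (s + k + 1))) y ^ 2 = _
      simp only [Matrix.vecMul, dotProduct, rowCorr, sq, Finset.sum_mul_sum]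
      rw [Finset.sum_comm]
      refine Finset.sum_congr rfl fun x _ ↦ ?_
      rw [Finset.sum_comm]
      refine Finset.sum_congr rfl fun x' _ ↦ ?_
      rw [Finset.mul_sum]
      refine Finset.sum_congr rfl fun y _ ↦ by ring
    have hprod : ∀ x x' G G', (∀ i ∈ Finset.Ioc s (s + k), G i = G' i) →
        w G x * w G x' = w G' x * w G' x' := fun x x' G G' h ↦ by rw [hwdep G G' h]
    have hint : ∀ x x', Integrable
        (fun G ↦ w G x * w G x' * rowCorr (G (s + k + 1)) x x') (dynamicER n p) := by
      intro x x'
      refine integrable_of_dependsOn p (S := Finset.Ioc s (s + k + 1)) fun G G' h ↦ ?_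
      rw [hwdep G G' fun i hi ↦ h i ?_, h (s + k + 1) ?_]
      all_goals
        simp only [Finset.mem_Ioc] at *
        omega
    -- As `∑ w = 0`, the off-diagonal terms contribute `β ((∑ w)² - ∑ w²) = -β ∑ w² ≤ 0`.
    have hquad : ∀ G, ∑ x, ∑ x', w G x * w G x' * (if x = x' then α else β) ≤
        3 / 4 * ∑ x, w G x ^ 2 := by
      intro G
      have h1 : ∀ x x', w G x * w G x' * (if x = x' then α else β) =
          w G x * w G x' * β + if x = x' then (α - β) * (w G x * w G x') else 0 := by
        intro x x'
        split_ifs <;> ring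
      simp only [h1, Finset.sum_add_distrib, Finset.sum_ite_eq, Finset.mem_univ, if_true,
        ← Finset.sum_mul, ← Finset.mul_sum, hwsum, ← sq, mul_zero, zero_mul, zero_add]
      have h2 : 0 ≤ ∑ x, w G x ^ 2 := Finset.sum_nonneg fun x _ ↦ sq_nonneg _
      exact mul_le_mul_of_nonneg_right (by linarith) h2
    have hint2 : ∀ x x', Integrable (fun G ↦ w G x * w G x') (dynamicER n p) :=
      fun x x' ↦ integrable_of_dependsOn p (hprod x x')
    calc ∫ G, ∑ y, (v ᵥ* stepProd (fun t ↦ lazyWalk (G t)) s (k + 1)) y ^ 2 ∂dynamicER n p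
        = ∫ G, ∑ x, ∑ x', w G x * w G x' * rowCorr (G (s + k + 1)) x x' ∂dynamicER n p := by
          simp only [hexp]
      _ = ∑ x, ∑ x', (∫ G, w G x * w G x' ∂dynamicER n p) * (if x = x' then α else β) := by
          rw [integral_finsetSum _ fun x _ ↦ integrable_finsetSum _ fun x' _ ↦ hint x x']
          refine Finset.sum_congr rfl fun x _ ↦ ?_
          rw [integral_finsetSum _ fun x' _ ↦ hint x x']
          refine Finset.sum_congr rfl fun x' _ ↦ ?_
          rw [integral_mul_eval p (hprod x x') (by simp) fun g ↦ rowCorr g x x', hκ]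
      _ = ∫ G, ∑ x, ∑ x', w G x * w G x' * (if x = x' then α else β) ∂dynamicER n p := by
          rw [integral_finsetSum _ fun x _ ↦ integrable_finsetSum _ fun x' _ ↦
            (hint2 x x').mul_const _]
          refine Finset.sum_congr rfl fun x _ ↦ ?_
          rw [integral_finsetSum _ fun x' _ ↦ (hint2 x x').mul_const _]
          simp only [integral_mul_const]
      _ ≤ ∫ G, 3 / 4 * ∑ x, w G x ^ 2 ∂dynamicER n p := by
          refine integral_mono ?_ ?_ hquad
          · exact integrable_of_dependsOn p fun G G' h ↦ by rw [hwdep G G' h]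
          · exact integrable_of_dependsOn p fun G G' h ↦ by rw [hwdep G G' h]
      _ ≤ (3 / 4) ^ (k + 1) * ∑ x, v x ^ 2 := by
          rw [integral_const_mul, pow_succ', mul_assoc]
          exact mul_le_mul_of_nonneg_left ih (by norm_num)

end DynamicER

/-! ### Mixing of the dynamic random graph -/

namespace DynamicER

open ProbabilityTheory unitInterval

variable {n : ℕ}

lemma rowGap_stepProd_congr (s : ℤ) (k : ℕ) (G G' : ℤ → SimpleGraph (Fin n))
    (h : ∀ i ∈ Finset.Ioc s (s + k), G i = G' i) :
    rowGap (stepProd (fun t ↦ lazyWalk (G t)) s k) =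
      rowGap (stepProd (fun t ↦ lazyWalk (G' t)) s k) := by
  rw [stepProd_congr fun i hi ↦ by rw [h i hi]]

open scoped Matrix in
lemma integral_rowGap_stepProd_le (hn : 2 ≤ n) {p : I} (hp : (1 - (p : ℝ)) ^ (n - 1) ≤ 1 / 2)
    (s : ℤ) (k : ℕ) :
    ∫ G, rowGap (stepProd (fun t ↦ lazyWalk (G t)) s k) ∂dynamicER n p ≤
      2 * n ^ 2 * (3 / 4) ^ k := by
  have hdep : ∀ x x' : Fin n, Integrable (fun G : ℤ → SimpleGraph (Fin n) ↦
      ∑ y, (stepProd (fun t ↦ lazyWalk (G t)) s k x y -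
        stepProd (fun t ↦ lazyWalk (G t)) s k x' y) ^ 2) (dynamicER n p) := fun x x' ↦
    integrable_of_dependsOn p (S := Finset.Ioc s (s + k)) fun G G' h ↦ by
      rw [stepProd_congr fun i hi ↦ by rw [h i hi]]
  have hpair : ∀ x x' : Fin n, ∫ G, ∑ y, (stepProd (fun t ↦ lazyWalk (G t)) s k x y -
      stepProd (fun t ↦ lazyWalk (G t)) s k x' y) ^ 2 ∂dynamicER n p ≤ 2 * (3 / 4) ^ k := by
    intro x x'
    set v : Fin n → ℝ := Pi.single x 1 - Pi.single x' 1 with hv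
    have h0 : ∑ z, v z = 0 := by simp [hv]
    have h2 : ∑ z, v z ^ 2 ≤ 2 := by
      calc ∑ z, v z ^ 2
          ≤ ∑ z, ((Pi.single x 1 : Fin n → ℝ) z + (Pi.single x' 1 : Fin n → ℝ) z) := by
            refine Finset.sum_le_sum fun z _ ↦ ?_
            simp only [hv, Pi.sub_apply, Pi.single_apply]
            split_ifs <;> norm_num
        _ = 2 := by simp [Finset.sum_add_distrib]; norm_num
    have h := integral_sum_sq_vecMul_stepProd_le hn hp s h0 k
    simp only [hv, Matrix.sub_vecMul, Matrix.single_one_vecMul, Pi.sub_apply, Matrix.row] at h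
    refine h.trans ?_
    rw [mul_comm]
    exact mul_le_mul_of_nonneg_right h2 (by positivity)
  unfold rowGap
  rw [integral_finsetSum _ fun x _ ↦ integrable_finsetSum _ fun x' _ ↦ hdep x x']
  calc _ ≤ ∑ _x : Fin n, ∑ _x' : Fin n, (2 * (3 / 4) ^ k : ℝ) := by
        refine Finset.sum_le_sum fun x _ ↦ ?_
        rw [integral_finsetSum _ fun x' _ ↦ hdep x x']
        exact Finset.sum_le_sum fun x' _ ↦ hpair x x'
    _ = 2 * n ^ 2 * (3 / 4) ^ k := by
        simp only [Finset.sum_const, Finset.card_univ, Fintype.card_fin, nsmul_eq_mul]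
        ring

/-- Since `E[rowGap P^{t-k,t}]` is summable in `k`, the rows of `P^{t-k,t}` merge almost surely. -/
lemma ae_targetExists (hn : 2 ≤ n) {p : I} (hp : (1 - (p : ℝ)) ^ (n - 1) ≤ 1 / 2) :
    ∀ᵐ G ∂dynamicER n p, ∀ t, TargetExists (fun s ↦ lazyWalk (G s)) t := by
  refine ae_all_iff.2 fun t ↦ ?_
  set f : ℕ → (ℤ → SimpleGraph (Fin n)) → ℝ := fun k G ↦
    rowGap (stepProd (fun s ↦ lazyWalk (G s)) (t - k) k) with hf
  have hmeas : ∀ k, Measurable (f k) := fun k ↦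
    measurable_of_dependsOn (rowGap_stepProd_congr (t - k) k)
  have hfin : ∫⁻ G, ∑' k, ENNReal.ofReal (f k G) ∂dynamicER n p ≠ ∞ := by
    rw [lintegral_tsum fun k ↦ (hmeas k).ennreal_ofReal.aemeasurable]
    have hle : ∀ k, ∫⁻ G, ENNReal.ofReal (f k G) ∂dynamicER n p ≤
        ENNReal.ofReal (2 * n ^ 2 * (3 / 4) ^ k) := by
      intro k
      rw [← ofReal_integral_eq_lintegral_ofReal
        (integrable_of_dependsOn p (rowGap_stepProd_congr (t - k) k))
        (.of_forall fun G ↦ rowGap_nonneg _)]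
      exact ENNReal.ofReal_le_ofReal (integral_rowGap_stepProd_le hn hp _ k)
    refine ne_top_of_le_ne_top ?_ (ENNReal.tsum_le_tsum hle)
    exact ((summable_geometric_of_lt_one (by norm_num) (by norm_num)).mul_left _).tsum_ofReal_ne_top
  filter_upwards [ae_lt_top (Measurable.tsum fun k ↦ (hmeas k).ennreal_ofReal) hfin]
    with G hG
  refine targetExists_of_tendsto_rowGap (fun s ↦ lazyWalk_mem_rowStochastic (G s)) t ?_
  have h := (ENNReal.tendsto_toReal ENNReal.zero_ne_top).comp
    (ENNReal.tendsto_atTop_zero_of_tsum_ne_top hG.ne)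
  refine h.congr fun k ↦ ?_
  simp [hf, ENNReal.toReal_ofReal (rowGap_nonneg _)]

/-- A vertex of `G(n, η log n / (n - 1))` is isolated with probability at most `1 / 2`: here
`p (n - 1) ≥ min (n - 1, η log n) ≥ log 2`. -/
lemma one_sub_edgeProb_pow_le {η : ℝ} (hη : 50 < η) (hn : 2 ≤ n) :
    (1 - (edgeProb η n : ℝ)) ^ (n - 1) ≤ 1 / 2 := by
  have hn' : (2 : ℝ) ≤ n := by exact_mod_cast hn
  have hlog2 : Real.log 2 ≤ Real.log n := Real.log_le_log (by norm_num) hn'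
  have hpos : 0 < Real.log 2 := Real.log_pos (by norm_num)
  have hlt : Real.log 2 < 1 := Real.log_two_lt_d9.trans (by norm_num)
  have hp : Real.log 2 / ((n : ℝ) - 1) ≤ edgeProb η n := by
    rw [edgeProb, Set.coe_projIcc]
    refine le_max_of_le_right (le_min ?_ ?_)
    · rw [div_le_one (by linarith)]
      linarith
    · gcongr
      · linarith
      · nlinarith
  calc (1 - (edgeProb η n : ℝ)) ^ (n - 1)
      ≤ Real.exp (-(Real.log 2 / ((n : ℝ) - 1))) ^ (n - 1) := by
        refine pow_le_pow_left₀ (sub_nonneg.2 (edgeProb η n).2.2) ?_ _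
        linarith [Real.add_one_le_exp (-(Real.log 2 / ((n : ℝ) - 1)))]
    _ = 1 / 2 := by
        have h1 : ((n - 1 : ℕ) : ℝ) = n - 1 := by push_cast [show 1 ≤ n by omega]; rfl
        rw [← Real.exp_nat_mul, h1, mul_neg, mul_div_cancel₀ _ (by linarith), Real.exp_neg,
          Real.exp_log (by norm_num)]
        norm_num

/-- After `⌊24 (log n + log ε⁻¹)⌋` steps the factor `(3 / 4) ^ k` is of order `(ε / n) ^ 6`. -/
lemma three_quarters_pow_floor_le {ε : ℝ} (hε : 0 < ε) (hn : 0 < n) :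
    (3 / 4 : ℝ) ^ ⌊24 * (Real.log n + Real.log ε⁻¹)⌋₊ ≤ 4 / 3 * (ε / n) ^ 6 := by
  have hn' : (0 : ℝ) < n := by exact_mod_cast hn
  set L := Real.log n + Real.log ε⁻¹ with hL
  set k := ⌊24 * L⌋₊
  have hk : 24 * L < k + 1 := Nat.lt_floor_add_one _
  have h1 : (3 / 4 : ℝ) ^ (k + 1) ≤ (ε / n) ^ 6 := by
    calc (3 / 4 : ℝ) ^ (k + 1) ≤ Real.exp (-(1 / 4)) ^ (k + 1) := by
          refine pow_le_pow_left₀ (by norm_num) ?_ _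
          linarith [Real.add_one_le_exp (-(1 / 4) : ℝ)]
      _ = Real.exp (-((k + 1) / 4)) := by
          rw [← Real.exp_nat_mul]
          push_cast
          ring_nf
      _ ≤ Real.exp (((6 : ℕ) : ℝ) * -L) := by
          refine Real.exp_le_exp.2 ?_
          push_cast
          linarith
      _ = (ε / n) ^ 6 := by
          rw [Real.exp_nat_mul, hL, Real.log_inv, neg_add, neg_neg, Real.exp_add, Real.exp_neg,
            Real.exp_log hn', Real.exp_log hε]
          ring
  rw [pow_succ] at h1
  linarith

lemma mixingTime_le {P : ℤ → Matrix (Fin n) (Fin n) ℝ} {ε : ℝ} {s : ℤ} {k : ℕ}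
    (h : mixDist P s (s + k) ≤ ε) : mixingTime P ε s ≤ k :=
  iInf₂_le k h

/-- The union of the null event that some target distribution does not exist and of the event
that the rows of `P^{0,k}` have not merged after `k = ⌊24 (log n + log ε⁻¹)⌋` steps contains the
event that the walk does not mix in time; the second event is controlled by Markov's inequality. -/
lemma dynamicER_mixing_compl_le {η : ℝ} (hη : 50 < η) {ε : ℝ} (hε : 0 < ε) (hε1 : ε < 1)
    (hn : 2 ≤ n) :
    dynamicER n (edgeProb η n) {G | (∀ t, TargetExists (fun s ↦ lazyWalk (G s)) t) ∧
      (mixingTime (fun s ↦ lazyWalk (G s)) ε 0 : ℝ≥0∞) ≤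
        ENNReal.ofReal (24 * (Real.log n + Real.log ε⁻¹))}ᶜ ≤ ENNReal.ofReal (3 / n ^ 2) := by
  set μ := dynamicER n (edgeProb η n)
  have hp := one_sub_edgeProb_pow_le hη hn
  have hn' : (0 : ℝ) < n := by exact_mod_cast (by omega : 0 < n)
  set L := Real.log n + Real.log ε⁻¹ with hL
  have hLpos : 0 ≤ 24 * L := by
    have h1 : 0 ≤ Real.log n := Real.log_natCast_nonneg n
    have h2 : 0 ≤ Real.log ε⁻¹ := Real.log_nonneg ((one_le_inv₀ hε).2 hε1.le)
    positivity
  set k := ⌊24 * L⌋₊ with hk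
  set D : (ℤ → SimpleGraph (Fin n)) → ℝ := fun G ↦
    rowGap (stepProd (fun s ↦ lazyWalk (G s)) 0 k) with hD
  have hmarkov : μ {G | (ε / n) ^ 2 ≤ D G} ≤ ENNReal.ofReal (3 / n ^ 2) := by
    have h1 := mul_meas_ge_le_integral_of_nonneg (μ := μ) (f := D)
      (.of_forall fun G ↦ rowGap_nonneg _)
      (integrable_of_dependsOn _ (rowGap_stepProd_congr 0 k)) ((ε / n) ^ 2)
    have h2 := three_quarters_pow_floor_le hε (by omega : 0 < n)
    have h3 : (ε / n) ^ 2 * μ.real {G | (ε / n) ^ 2 ≤ D G} ≤ (ε / n) ^ 2 * (3 / n ^ 2) := by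
      calc _ ≤ 2 * (n : ℝ) ^ 2 * (3 / 4) ^ k := h1.trans (integral_rowGap_stepProd_le hn hp 0 k)
        _ ≤ 2 * (n : ℝ) ^ 2 * (4 / 3 * (ε / n) ^ 6) := by gcongr
        _ = (ε / n) ^ 2 * (8 / 3 * ε ^ 4 / n ^ 2) := by field_simp; norm_num
        _ ≤ (ε / n) ^ 2 * (3 / n ^ 2) := by
          have h4 : ε ^ 4 ≤ 1 := pow_le_one₀ hε.le hε1.le
          gcongr
          linarith
    rw [← ofReal_measureReal]
    exact ENNReal.ofReal_le_ofReal (le_of_mul_le_mul_left h3 (by positivity))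
  have hnull : μ {G | ¬ ∀ t, TargetExists (fun s ↦ lazyWalk (G s)) t} = 0 :=
    ae_iff.1 (ae_targetExists hn hp)
  refine (measure_mono ?_).trans ((measure_union_le _ _).trans
    ((add_le_add hnull.le hmarkov).trans_eq (zero_add _)))
  rw [Set.compl_subset_iff_union, Set.eq_univ_iff_forall]
  intro G
  by_cases hG : ∀ t, TargetExists (fun s ↦ lazyWalk (G s)) t
  swap
  · exact .inr (.inl hG)
  by_cases hGD : (ε / n) ^ 2 ≤ D G
  · exact .inr (.inr hGD)
  refine .inl ⟨hG, ?_⟩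
  have hdist : mixDist (fun s ↦ lazyWalk (G s)) 0 (0 + (k : ℤ)) ≤ ε := by
    refine (mixDist_le (fun s ↦ lazyWalk_mem_rowStochastic (G s)) 0 k (hG _)).trans ?_
    have h1 : √(D G) ≤ ε / n := Real.sqrt_le_iff.2 ⟨by positivity, (not_le.1 hGD).le⟩
    calc (n : ℝ) * √(D G) ≤ n * (ε / n) := by gcongr
      _ = ε := mul_div_cancel₀ _ hn'.ne'
  calc (mixingTime (fun s ↦ lazyWalk (G s)) ε 0 : ℝ≥0∞) ≤ ((k : ℕ∞) : ℝ≥0∞) := by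
        exact_mod_cast mixingTime_le hdist
    _ = ENNReal.ofReal k := by simp
    _ ≤ ENNReal.ofReal (24 * L) := ENNReal.ofReal_le_ofReal (Nat.floor_le hLpos)

end DynamicER

theorem mainTheorem2 (η : ℝ) (hη : 50 < η) :
    ∃ c : ℝ, 0 < c ∧ ∀ ε : ℝ, 0 < ε → ε < 1 →
      Tendsto
        (fun n : ℕ => DynamicER.dynamicER n (DynamicER.edgeProb η n)
          {G : ℤ → SimpleGraph (Fin n) |
            (∀ t : ℤ, DynamicER.TargetExists (fun s => DynamicER.lazyWalk (G s)) t) ∧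
            (DynamicER.mixingTime (fun s => DynamicER.lazyWalk (G s)) ε 0 : ℝ≥0∞)
              ≤ ENNReal.ofReal (c * (Real.log n + Real.log ε⁻¹))})
        atTop (𝓝 1) := by
  refine ⟨24, by norm_num, fun ε hε hε1 ↦ ?_⟩
  have hlim : Tendsto (fun n : ℕ ↦ 1 - ENNReal.ofReal (3 / (n : ℝ) ^ 2)) atTop (𝓝 1) := by
    have h1 : Tendsto (fun n : ℕ ↦ 3 / (n : ℝ) ^ 2) atTop (𝓝 0) :=
      tendsto_const_nhds.div_atTop
        ((tendsto_pow_atTop two_ne_zero).comp tendsto_natCast_atTop_atTop)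
    have h2 := ENNReal.Tendsto.sub (tendsto_const_nhds (x := (1 : ℝ≥0∞)))
      (ENNReal.tendsto_ofReal h1) (.inl ENNReal.one_ne_top)
    simpa using h2
  refine tendsto_of_tendsto_of_tendsto_of_le_of_le' hlim tendsto_const_nhds ?_
    (.of_forall fun n ↦ prob_le_one)
  filter_upwards [eventually_ge_atTop 2] with n hn
  -- Subadditivity suffices here, so the measurability of the event is not needed.
  refine tsub_le_iff_right.2 ?_
  calc (1 : ℝ≥0∞) = DynamicER.dynamicER n (DynamicER.edgeProb η n) Set.univ := measure_univ.symm
    _ ≤ _ := measure_univ_le_add_compl _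
    _ ≤ _ := by gcongr; exact DynamicER.dynamicER_mixing_compl_le hη hε hε1 hn
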